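/- Let $M$ be a $(2n+1)$-dimensional smooth manifold with an almost paracontact metric structure $(\varphi,\xi,\eta,g)$: a smooth $(1,1)$-tensor field $\varphi$, a smooth vector field $\xi$, a smooth $1$-form $\eta$ and a smooth pseudo-Riemannian metric $g$ such that $$\varphi^2=\mathrm{id}-\eta\otimes\xi,\qquad \eta(\xi)=1,\qquad \varphi\xi=0,\qquad g(\varphi x,\varphi y)=-g(x,y)+\eta(x)\eta(y).$$ Let $\nabla$ be the Levi-Civita connection of $g$, let $F(x,y,z)=g((\nabla_x\varphi)y,z)$ be the structure tensor, let $\phi(x,y)=g(\varphi x,y)$ be the fundamental $2$-form, and let $d\eta(X,Y)=\frac12\bigl(X\eta(Y)-Y\eta(X)-\eta([X,Y])\bigr)$. The structure is called *paracontact metric* if $\phi=d\eta$. For $p\in M$ let $\mathcal F_p$ be the space of $(0,3)$-tensors $F$ on $T_pM$ with $F(x,y,z)=-F(x,z,y)$ and $F(x,y,z)=F(x,\varphi y,\varphi z)-\eta(y)F(x,z,\xi)+\eta(z)F(x,y,\xi)$ for all $x,y,z\in T_pM$. For $F\in\mathcal F_p$ put $\theta_F(x)=\sum_{i,j}g^{ij}F(e_i,e_j,x)$,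 where $(e_i)_{i=1}^{2n}$ is a basis of $\ker\eta_p$ and $(g^{ij})$ is the inverse of the matrix $(g(e_i,e_j))$. Define the following subsets of $\mathcal F_p$ (conditions for all $x,y,z\in T_pM$): * $\mathbb G_4$: $F(\varphi x,\varphi y,z)=F(x,y,z)$ and $F(x,y,z)+F(y,z,x)+F(z,x,y)=0$; * $\mathbb G_5$: $F(x,y,z)=\frac{\theta_F(\xi)}{2n}\{\eta(y)g(\varphi x,\varphi z)-\eta(z)g(\varphi x,\varphi y)\}$; * $\overline{\mathbb G}_5$: $F\in\mathbb G_5$ and $\theta_F(\xi)=2n$; * $\mathbb G_{10}$: $F(x,y,z)=-\eta(y)F(x,z,\xi)+\eta(z)F(x,y,\xi)$ and $F(x,y,\xi)=F(y,x,\xi)=F(\varphi x,\varphi y,\xi)$. The sum of the linear subspaces $\mathbb G_4,\mathbb G_5,\mathbb G_{10}$ is direct; $\overline{\mathbb G}_5\oplus\mathbb G_i\oplus\cdots$ denotes the set of sums of a tensor of $\overline{\mathbb G}_5$ and tensors of $\mathbb G_i,\dots$. The manifold is said to belong to one of these classes if at every $p\in M$ its structure tensor belongs to the corresponding subset of $\mathcal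 F_p$. **Theorem.** $M(\varphi,\xi,\eta,g)$ is paracontact metric if and only if $M$ belongs to one of the classes $$\overline{\mathbb G}_5,\qquad \overline{\mathbb G}_5\oplus\mathbb G_4,\qquad \overline{\mathbb G}_5\oplus\mathbb G_{10},\qquad \overline{\mathbb G}_5\oplus\mathbb G_4\oplus\mathbb G_{10}.$$ -/

import Mathlib

open Bundle VectorField Manifold
open scoped ContDiff Pointwise

noncomputable section

/-! ### Pseudo-Riemannian metrics -/

section Metric

variable {E : Type*} [NormedAddCommGroup E] [NormedSpace ℝ E]
  {H : Type*} [TopologicalSpace H] (I : ModelWithCorners ℝ E H)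
  (M : Type*) [TopologicalSpace M] [ChartedSpace H M] [IsManifold I ∞ M]

/-- A smooth pseudo-Riemannian metric on `M`: a smooth symmetric `(0,2)`-tensor field, nondegenerate
at every point. -/
structure PseudoRiemannianMetric where
  /-- The scalar product on the tangent space at `p`. -/
  val (p : M) : TangentSpace I p →L[ℝ] TangentSpace I p →L[ℝ] ℝ
  symm (p : M) (v w : TangentSpace I p) : val p v w = val p w v
  nondegenerate (p : M) (v : TangentSpace I p) (hv : ∀ w, val p v w = 0) : v = 0
  contMDiff : ContMDiff I (I.prod 𝓘(ℝ, E →L[ℝ] E →L[ℝ] ℝ)) ∞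
    (fun p ↦ TotalSpace.mk' (E →L[ℝ] E →L[ℝ] ℝ) p (val p))

end Metric

namespace PseudoRiemannianMetric

variable {E : Type*} [NormedAddCommGroup E] [NormedSpace ℝ E]
  {H : Type*} [TopologicalSpace H] {I : ModelWithCorners ℝ E H}
  {M : Type*} [TopologicalSpace M] [ChartedSpace H M] [IsManifold I ∞ M]
  (g : PseudoRiemannianMetric I M)

lemma mdifferentiableAt {Y Z : Π p : M, TangentSpace I p} {p : M}
    (hY : MDiffAt (T% Y) p) (hZ : MDiffAt (T% Z) p) :
    MDiffAt (fun q ↦ g.val q (Y q) (Z q)) p := by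
  have h := MDifferentiableAt.clm_bundle_apply₂ (F₁ := E) (F₂ := E)
    (F₃ := ℝ) (E₃ := Bundle.Trivial M ℝ)
    ((g.contMDiff p).mdifferentiableAt (by simp)) hY hZ
  simp only [mdifferentiableAt_totalSpace] at h
  exact h.2

/-- The metric at `p`, as a bilinear form on the tangent space. -/
def bilin (p : M) : LinearMap.BilinForm ℝ (TangentSpace I p) :=
  LinearMap.mk₂ ℝ (fun v w ↦ g.val p v w) (by simp) (by simp) (by simp) (by simp)

lemma bilin_nondegenerate (p : M) : (g.bilin p).Nondegenerate :=
  ⟨fun v hv ↦ g.nondegenerate p v hv,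
    fun v hv ↦ g.nondegenerate p v fun w ↦ (g.symm p v w).trans (hv w)⟩

lemma ext_val {p : M} {v w : TangentSpace I p} (h : ∀ z, g.val p v z = g.val p w z) : v = w :=
  sub_eq_zero.mp <| g.nondegenerate p _ fun z ↦ by simp [h z]

/-- The right-hand side of the Koszul formula, i.e. the value at `p` of `g(∇_X Y, Z)`. -/
def koszul (X Y Z : Π p : M, TangentSpace I p) (p : M) : ℝ :=
  (1 / 2) * (d% (fun q ↦ g.val q (Y q) (Z q)) p (X p)
    + d% (fun q ↦ g.val q (X q) (Z q)) p (Y p)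
    - d% (fun q ↦ g.val q (X q) (Y q)) p (Z p)
    + g.val p (mlieBracket I X Y p) (Z p)
    - g.val p (mlieBracket I X Z p) (Y p)
    - g.val p (mlieBracket I Y Z p) (X p))

variable {g} {p : M}

lemma koszul_metric {X Y Z : Π p : M, TangentSpace I p} :
    g.koszul X Y Z p + g.koszul X Z Y p = d% (fun q ↦ g.val q (Y q) (Z q)) p (X p) := by
  have : (fun q ↦ g.val q (Z q) (Y q)) = (fun q ↦ g.val q (Y q) (Z q)) := by
    ext q; exact g.symm _ _ _
  simp only [koszul, this, mlieBracket_swap_apply (V := Z) (W := Y)]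
  simp
  ring

lemma koszul_torsion {X Y Z : Π p : M, TangentSpace I p} :
    g.koszul X Y Z p - g.koszul Y X Z p = g.val p (mlieBracket I X Y p) (Z p) := by
  have : (fun q ↦ g.val q (Y q) (X q)) = (fun q ↦ g.val q (X q) (Y q)) := by
    ext q; exact g.symm _ _ _
  simp only [koszul, this, mlieBracket_swap_apply (V := Y) (W := X)]
  simp
  ring

variable [CompleteSpace E]

lemma koszul_tensorial_left {Y Z : Π p : M, TangentSpace I p}
    (hY : MDiffAt (T% Y) p) (hZ : MDiffAt (T% Z) p) :
    TensorialAt I E (fun X ↦ g.koszul X Y Z p) p where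
  smul {f X} hf hX := by
    have h1 := mvfderiv_mul hf (g.mdifferentiableAt hX hZ)
    have h2 := mvfderiv_mul hf (g.mdifferentiableAt hX hY)
    simp only [Pi.mul_def] at h1 h2
    simp [koszul, mlieBracket_smul_left hf hX, h1, h2]
    rw [g.symm p (X p) (Y p), g.symm p (X p) (Z p)]
    ring
  add {X X'} hX hX' := by
    have h1 := mvfderiv_add (g.mdifferentiableAt hX hZ) (g.mdifferentiableAt hX' hZ)
    have h2 := mvfderiv_add (g.mdifferentiableAt hX hY) (g.mdifferentiableAt hX' hY)
    simp only [Pi.add_def] at h1 h2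
    simp [koszul, mlieBracket_add_left hX hX', h1, h2]
    ring

lemma koszul_tensorial_right {X Y : Π p : M, TangentSpace I p}
    (hX : MDiffAt (T% X) p) (hY : MDiffAt (T% Y) p) :
    TensorialAt I E (fun Z ↦ g.koszul X Y Z p) p where
  smul {f Z} hf hZ := by
    have h1 := mvfderiv_mul hf (g.mdifferentiableAt hY hZ)
    have h2 := mvfderiv_mul hf (g.mdifferentiableAt hX hZ)
    simp only [Pi.mul_def] at h1 h2
    simp [koszul, mlieBracket_smul_right hf hZ, h1, h2]
    rw [g.symm p (Z p) (X p), g.symm p (Z p) (Y p)]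
    ring
  add {Z Z'} hZ hZ' := by
    have h1 := mvfderiv_add (g.mdifferentiableAt hY hZ) (g.mdifferentiableAt hY hZ')
    have h2 := mvfderiv_add (g.mdifferentiableAt hX hZ) (g.mdifferentiableAt hX hZ')
    simp only [Pi.add_def] at h1 h2
    simp [koszul, mlieBracket_add_right hZ hZ', h1, h2]
    ring

lemma koszul_add_middle {X Y Y' Z : Π p : M, TangentSpace I p}
    (hX : MDiffAt (T% X) p) (hY : MDiffAt (T% Y) p) (hY' : MDiffAt (T% Y') p)
    (hZ : MDiffAt (T% Z) p) :
    g.koszul X (Y + Y') Z p = g.koszul X Y Z p + g.koszul X Y' Z p := by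
  have h1 := mvfderiv_add (g.mdifferentiableAt hY hZ) (g.mdifferentiableAt hY' hZ)
  have h2 := mvfderiv_add (g.mdifferentiableAt hX hY) (g.mdifferentiableAt hX hY')
  simp only [Pi.add_def] at h1 h2
  simp [koszul, mlieBracket_add_right hY hY', mlieBracket_add_left hY hY', h1, h2]
  ring

lemma koszul_smul_middle {X Y Z : Π p : M, TangentSpace I p} {f : M → ℝ}
    (hf : MDiffAt f p)
    (hX : MDiffAt (T% X) p) (hY : MDiffAt (T% Y) p) (hZ : MDiffAt (T% Z) p) :
    g.koszul X (f • Y) Z p = f p * g.koszul X Y Z p + d% f p (X p) * g.val p (Y p) (Z p) := by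
  have h1 := mvfderiv_mul hf (g.mdifferentiableAt hY hZ)
  have h2 := mvfderiv_mul hf (g.mdifferentiableAt hX hY)
  simp only [Pi.mul_def] at h1 h2
  simp [koszul, mlieBracket_smul_right hf hY, mlieBracket_smul_left hf hY, h1, h2]
  rw [g.symm p (Y p) (X p)]
  ring

end PseudoRiemannianMetric

instance TangentSpace.instFiniteDimensional {E : Type*} [NormedAddCommGroup E] [NormedSpace ℝ E]
    [FiniteDimensional ℝ E] {H : Type*} [TopologicalSpace H] (I : ModelWithCorners ℝ E H)
    {M : Type*} [TopologicalSpace M] [ChartedSpace H M] (p : M) :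
    FiniteDimensional ℝ (TangentSpace I p) :=
  inferInstanceAs (FiniteDimensional ℝ E)

instance TangentSpace.instT2Space {E : Type*} [NormedAddCommGroup E] [NormedSpace ℝ E]
    {H : Type*} [TopologicalSpace H] (I : ModelWithCorners ℝ E H)
    {M : Type*} [TopologicalSpace M] [ChartedSpace H M] (p : M) :
    T2Space (TangentSpace I p) :=
  inferInstanceAs (T2Space E)

/-! ### The Levi-Civita connection -/

namespace PseudoRiemannianMetric

variable {E : Type*} [NormedAddCommGroup E] [NormedSpace ℝ E] [FiniteDimensional ℝ E]
  [CompleteSpace E]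
  {H : Type*} [TopologicalSpace H] {I : ModelWithCorners ℝ E H}
  {M : Type*} [TopologicalSpace M] [ChartedSpace H M] [IsManifold I ∞ M]
  (g : PseudoRiemannianMetric I M)

/-- For a vector field `Y` differentiable at `p`, the bilinear form `(x, z) ↦ g(∇_x Y, z)` on the
tangent space at `p`, given by the Koszul formula. -/
def koszulForm (Y : Π p : M, TangentSpace I p) (p : M) (hY : MDiffAt (T% Y) p) :
    TangentSpace I p →L[ℝ] TangentSpace I p →L[ℝ] ℝ :=
  TensorialAt.mkHom₂ (I := I) (F := E) (F' := E) (fun X Z ↦ g.koszul X Y Z p) p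
    (fun _ hZ ↦ koszul_tensorial_left hY hZ) (fun _ hX ↦ koszul_tensorial_right hX hY)

open Classical in
/-- The operator `Y ↦ (x ↦ ∇_x Y)`: `∇_x Y` is the vector which is `g`-dual to the linear form
`z ↦ g(∇_x Y, z)` of the Koszul formula. (Junk value `0` at points where `Y` is not
differentiable.) -/
def leviCivitaFun (Y : Π p : M, TangentSpace I p) (p : M) :
    TangentSpace I p →L[ℝ] TangentSpace I p :=
  if hY : MDiffAt (T% Y) p then
    LinearMap.toContinuousLinearMap
      { toFun := fun x ↦ ((g.bilin p).toDual (g.bilin_nondegenerate p)).symm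
          (g.koszulForm Y p hY x).toLinearMap
        map_add' := fun x x' ↦ by
          rw [← map_add]; congr 1; ext z; simp
        map_smul' := fun c x ↦ by
          rw [RingHom.id_apply, ← map_smul]; congr 1; ext z; simp }
  else 0

lemma val_leviCivitaFun {X Y Z : Π p : M, TangentSpace I p} {p : M}
    (hX : MDiffAt (T% X) p) (hY : MDiffAt (T% Y) p) (hZ : MDiffAt (T% Z) p) :
    g.val p (g.leviCivitaFun Y p (X p)) (Z p) = g.koszul X Y Z p := by
  have h : g.bilin p (g.leviCivitaFun Y p (X p)) (Z p) = g.koszulForm Y p hY (X p) (Z p) := by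
    rw [leviCivitaFun, dif_pos hY]
    exact LinearMap.BilinForm.apply_toDual_symm_apply (hB := g.bilin_nondegenerate p) _ _
  exact h.trans (TensorialAt.mkHom₂_apply _ _ hX hZ)

/-- The Levi-Civita connection of a pseudo-Riemannian metric, built from the Koszul formula. As for
every `CovariantDerivative`, `g.leviCivita Y p x` is `∇_x Y`. -/
def leviCivita : CovariantDerivative I E (TangentSpace I : M → Type _) where
  toFun := g.leviCivitaFun
  isCovariantDerivativeOnUniv :=
    { add := fun {Y Y' p} hY hY' _ ↦ by
        have hs : MDiffAt (T% (Y + Y')) p := mdifferentiableAt_add_section hY hY'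
        ext x
        refine g.ext_val fun z ↦ ?_
        have hX := FiberBundle.mdifferentiableAt_extend I E x
        have hZ := FiberBundle.mdifferentiableAt_extend I E z
        have h1 := g.val_leviCivitaFun hX hs hZ
        have h2 := g.val_leviCivitaFun hX hY hZ
        have h3 := g.val_leviCivitaFun hX hY' hZ
        rw [koszul_add_middle hX hY hY' hZ, ← h2, ← h3] at h1
        simpa using h1
      leibniz := fun {Y f p} hY hf _ ↦ by
        have hs : MDiffAt (T% (f • Y)) p := hf.smul_section hY
        ext x
        refine g.ext_val fun z ↦ ?_
        have hX := FiberBundle.mdifferentiableAt_extend I E x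
        have hZ := FiberBundle.mdifferentiableAt_extend I E z
        have h1 := g.val_leviCivitaFun hX hs hZ
        have h2 := g.val_leviCivitaFun hX hY hZ
        rw [koszul_smul_middle hf hX hY hZ, ← h2] at h1
        simpa using h1 }

/-- The Levi-Civita connection is metric. -/
lemma leviCivita_metric {X Y Z : Π p : M, TangentSpace I p} {p : M}
    (hX : MDiffAt (T% X) p) (hY : MDiffAt (T% Y) p) (hZ : MDiffAt (T% Z) p) :
    d% (fun q ↦ g.val q (Y q) (Z q)) p (X p) =
      g.val p (g.leviCivita Y p (X p)) (Z p) + g.val p (Y p) (g.leviCivita Z p (X p)) := by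
  rw [g.symm p (Y p), ← koszul_metric, ← g.val_leviCivitaFun hX hY hZ,
    ← g.val_leviCivitaFun hX hZ hY]
  rfl

/-- The Levi-Civita connection is torsion-free. -/
lemma leviCivita_torsion : g.leviCivita.torsion = 0 := by
  rw [CovariantDerivative.torsion_eq_zero_iff]
  intro X Y p hX hY
  refine g.ext_val fun z ↦ ?_
  have hZ := FiberBundle.mdifferentiableAt_extend I E z
  have h1 := g.val_leviCivitaFun hX hY hZ
  have h2 := g.val_leviCivitaFun hY hX hZ
  have h3 := koszul_torsion (g := g) (p := p) (X := X) (Y := Y) (Z := FiberBundle.extend E z)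
  rw [← h1, ← h2] at h3
  simp only [FiberBundle.extend_apply_self] at h3
  rw [← h3, map_sub, _root_.sub_apply]
  rfl

end PseudoRiemannianMetric

/-! ### Derivatives of endomorphism fields and of one-forms -/

section Derivatives

variable {E : Type*} [NormedAddCommGroup E] [NormedSpace ℝ E]
  {H : Type*} [TopologicalSpace H] {I : ModelWithCorners ℝ E H}
  {M : Type*} [TopologicalSpace M] [ChartedSpace H M] [IsManifold I ∞ M]

lemma endomorphismField_mdifferentiableAt {φ : Π p : M, TangentSpace I p →L[ℝ] TangentSpace I p}
    (hφ : ContMDiff I (I.prod 𝓘(ℝ, E →L[ℝ] E)) ∞ (fun p ↦ TotalSpace.mk' (E →L[ℝ] E) p (φ p)))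
    {Y : Π p : M, TangentSpace I p} {p : M} (hY : MDiffAt (T% Y) p) :
    MDiffAt (T% (fun q ↦ φ q (Y q))) p :=
  MDifferentiableAt.clm_bundle_apply (F₁ := E) (F₂ := E)
    ((hφ p).mdifferentiableAt (by simp)) hY

lemma oneForm_mdifferentiableAt {η : Π p : M, TangentSpace I p →L[ℝ] ℝ}
    (hη : ContMDiff I (I.prod 𝓘(ℝ, E →L[ℝ] ℝ)) ∞ (fun p ↦ TotalSpace.mk' (E →L[ℝ] ℝ) p (η p)))
    {Y : Π p : M, TangentSpace I p} {p : M} (hY : MDiffAt (T% Y) p) :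
    MDiffAt (fun q ↦ η q (Y q)) p := by
  have h := MDifferentiableAt.clm_bundle_apply (F₁ := E) (F₂ := ℝ) (E₂ := Bundle.Trivial M ℝ)
    ((hη p).mdifferentiableAt (by simp)) hY
  simp only [mdifferentiableAt_totalSpace] at h
  exact h.2

variable [FiniteDimensional ℝ E]

/-- `(∇_x φ) Y = ∇_x (φ Y) - φ (∇_x Y)` is tensorial in `Y`. -/
lemma covDerivEndomorphism_tensorial
    (cov : CovariantDerivative I E (TangentSpace I : M → Type _))
    {φ : Π p : M, TangentSpace I p →L[ℝ] TangentSpace I p}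
    (hφ : ContMDiff I (I.prod 𝓘(ℝ, E →L[ℝ] E)) ∞ (fun p ↦ TotalSpace.mk' (E →L[ℝ] E) p (φ p)))
    (p : M) :
    TensorialAt I E
      (fun Y : Π p : M, TangentSpace I p ↦ cov (fun q ↦ φ q (Y q)) p - φ p ∘L cov Y p) p where
  smul {f Y} hf hY := by
    have h : (fun q ↦ φ q ((f • Y) q)) = f • fun q ↦ φ q (Y q) := by ext q; simp
    rw [h, cov.isCovariantDerivativeOn.leibniz (endomorphismField_mdifferentiableAt hφ hY) hf,
      cov.isCovariantDerivativeOn.leibniz hY hf]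
    ext x
    simp
    module
  add {Y Y'} hY hY' := by
    have h : (fun q ↦ φ q ((Y + Y') q)) = (fun q ↦ φ q (Y q)) + fun q ↦ φ q (Y' q) := by
      ext q; simp
    rw [h, cov.isCovariantDerivativeOn.add (endomorphismField_mdifferentiableAt hφ hY)
      (endomorphismField_mdifferentiableAt hφ hY'), cov.isCovariantDerivativeOn.add hY hY']
    ext x
    simp
    module

/-- The covariant derivative of a smooth field of endomorphisms `φ` at the point `p`:
`covDerivEndomorphism cov hφ p y x` is `(∇_x φ) y = ∇_x (φ Y) - φ (∇_x Y)`, where `Y` is any vector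
field with value `y` at `p`. -/
def covDerivEndomorphism (cov : CovariantDerivative I E (TangentSpace I : M → Type _))
    {φ : Π p : M, TangentSpace I p →L[ℝ] TangentSpace I p}
    (hφ : ContMDiff I (I.prod 𝓘(ℝ, E →L[ℝ] E)) ∞ (fun p ↦ TotalSpace.mk' (E →L[ℝ] E) p (φ p)))
    (p : M) : TangentSpace I p →L[ℝ] TangentSpace I p →L[ℝ] TangentSpace I p :=
  TensorialAt.mkHom _ p (covDerivEndomorphism_tensorial cov hφ p)

variable [CompleteSpace E]

lemma extDeriv_oneForm_tensorial {η : Π p : M, TangentSpace I p →L[ℝ] ℝ}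
    (hη : ContMDiff I (I.prod 𝓘(ℝ, E →L[ℝ] ℝ)) ∞ (fun p ↦ TotalSpace.mk' (E →L[ℝ] ℝ) p (η p)))
    {Y : Π p : M, TangentSpace I p} {p : M} (hY : MDiffAt (T% Y) p) :
    TensorialAt I E (fun X : Π p : M, TangentSpace I p ↦
      (1 / 2 : ℝ) * (d% (fun q ↦ η q (Y q)) p (X p) - d% (fun q ↦ η q (X q)) p (Y p)
        - η p (mlieBracket I X Y p))) p where
  smul {f X} hf hX := by
    have h1 := mvfderiv_mul hf (oneForm_mdifferentiableAt hη hX)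
    simp only [Pi.mul_def] at h1
    simp [mlieBracket_smul_left hf hX, h1]
    ring
  add {X X'} hX hX' := by
    have h1 := mvfderiv_add (oneForm_mdifferentiableAt hη hX) (oneForm_mdifferentiableAt hη hX')
    simp only [Pi.add_def] at h1
    simp [mlieBracket_add_left hX hX', h1]
    ring

/-- The exterior derivative of a smooth one-form `η` at the point `p`, with the normalization
`dη(X, Y) = (X η(Y) - Y η(X) - η([X, Y])) / 2`. -/
def extDerivOneForm {η : Π p : M, TangentSpace I p →L[ℝ] ℝ}
    (hη : ContMDiff I (I.prod 𝓘(ℝ, E →L[ℝ] ℝ)) ∞ (fun p ↦ TotalSpace.mk' (E →L[ℝ] ℝ) p (η p)))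
    (p : M) : TangentSpace I p →L[ℝ] TangentSpace I p →L[ℝ] ℝ :=
  TensorialAt.mkHom₂ (I := I) (F := E) (F' := E)
    (fun X Y : Π p : M, TangentSpace I p ↦
      (1 / 2 : ℝ) * (d% (fun q ↦ η q (Y q)) p (X p) - d% (fun q ↦ η q (X q)) p (Y p)
        - η p (mlieBracket I X Y p))) p
    (fun _ hY ↦ extDeriv_oneForm_tensorial hη hY)
    (fun X hX ↦ by
      have h := extDeriv_oneForm_tensorial hη hX
      have e (Y : Π p : M, TangentSpace I p) :
          (1 / 2 : ℝ) * (d% (fun q ↦ η q (Y q)) p (X p) - d% (fun q ↦ η q (X q)) p (Y p)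
            - η p (mlieBracket I X Y p)) =
          -((1 / 2 : ℝ) * (d% (fun q ↦ η q (X q)) p (Y p) - d% (fun q ↦ η q (Y q)) p (X p)
            - η p (mlieBracket I Y X p))) := by
        rw [mlieBracket_swap_apply (V := Y) (W := X)]
        simp
        ring
      simp only [e]
      exact ⟨fun hf hY ↦ by rw [h.smul hf hY]; simp, fun hY hY' ↦ by rw [h.add hY hY']; ring⟩)

end Derivatives

/-! ### Almost paracontact metric vector spaces and classes of structure tensors -/

/-- The tensors of type `(0,3)` over `V`. -/
abbrev Tensor03 (V : Type*) [AddCommGroup V] [Module ℝ V] : Type _ :=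
  V →ₗ[ℝ] V →ₗ[ℝ] V →ₗ[ℝ] ℝ

/-- An almost paracontact structure `(φ, ξ, η)` with a compatible metric `g` on a vector space. -/
structure AlmostParacontactMetricSpace (V : Type*) [AddCommGroup V] [Module ℝ V] where
  φ : V →ₗ[ℝ] V
  ξ : V
  η : V →ₗ[ℝ] ℝ
  g : LinearMap.BilinForm ℝ V
  φ_sq (x : V) : φ (φ x) = x - η x • ξ
  η_ξ : η ξ = 1
  φ_ξ : φ ξ = 0
  g_symm (x y : V) : g x y = g y x
  g_nondegenerate (x : V) (hx : ∀ y, g x y = 0) : x = 0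
  compatible (x y : V) : g (φ x) (φ y) = -g x y + η x * η y

namespace AlmostParacontactMetricSpace

variable {V : Type*} [AddCommGroup V] [Module ℝ V] (S : AlmostParacontactMetricSpace V)

/-- The space `𝓕` of tensors with the symmetries of the structure tensor. -/
def tensorSpace : Submodule ℝ (Tensor03 V) where
  carrier := {F | ∀ x y z, F x y z = -F x z y ∧
    F x y z = F x (S.φ y) (S.φ z) - S.η y * F x z S.ξ + S.η z * F x y S.ξ}
  zero_mem' := by simp
  add_mem' {F F'} hF hF' x y z := by
    have h := hF x y z
    have h' := hF' x y z
    constructor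
    · simp only [LinearMap.add_apply]; linear_combination h.1 + h'.1
    · simp only [LinearMap.add_apply]; linear_combination h.2 + h'.2
  smul_mem' c {F} hF x y z := by
    have h := hF x y z
    constructor
    · simp only [LinearMap.smul_apply, smul_eq_mul]; linear_combination c * h.1
    · simp only [LinearMap.smul_apply, smul_eq_mul]; linear_combination c * h.2

/-- The paracontact distribution `D = ker η`. -/
abbrev distribution : Submodule ℝ V := LinearMap.ker S.η

/-- The Lee form `θ_F(x) = ∑ g^{ij} F(e_i, e_j, x)`, where `(e_i)` is a basis of `ker η` and
`(g^{ij})` is the inverse of the matrix `(g(e_i, e_j))`. -/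
def leeForm [FiniteDimensional ℝ V] (F : Tensor03 V) (x : V) : ℝ :=
  let e := Module.finBasis ℝ S.distribution
  ∑ i, ∑ j, (Matrix.of fun i j ↦ S.g (e i) (e j))⁻¹ i j * F (e i) (e j) x

lemma leeForm_add [FiniteDimensional ℝ V] (F F' : Tensor03 V) (x : V) :
    S.leeForm (F + F') x = S.leeForm F x + S.leeForm F' x := by
  simp [leeForm, mul_add, Finset.sum_add_distrib]

lemma leeForm_smul [FiniteDimensional ℝ V] (c : ℝ) (F : Tensor03 V) (x : V) :
    S.leeForm (c • F) x = c * S.leeForm F x := by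
  simp only [leeForm, LinearMap.smul_apply, smul_eq_mul, Finset.mul_sum]
  exact Finset.sum_congr rfl fun i _ ↦ Finset.sum_congr rfl fun j _ ↦ by ring

/-- The class `𝔾₄`: the tensors with `F(φx, φy, z) = F(x, y, z)` and vanishing cyclic sum. -/
def G4 : Submodule ℝ (Tensor03 V) where
  carrier := {F | F ∈ S.tensorSpace ∧ (∀ x y z, F (S.φ x) (S.φ y) z = F x y z) ∧
    ∀ x y z, F x y z + F y z x + F z x y = 0}
  zero_mem' := ⟨zero_mem _, by simp, by simp⟩
  add_mem' {F F'} hF hF' := by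
    refine ⟨add_mem hF.1 hF'.1, fun x y z ↦ ?_, fun x y z ↦ ?_⟩
    · simp only [LinearMap.add_apply]; linear_combination hF.2.1 x y z + hF'.2.1 x y z
    · simp only [LinearMap.add_apply]; linear_combination hF.2.2 x y z + hF'.2.2 x y z
  smul_mem' c {F} hF := by
    refine ⟨Submodule.smul_mem _ _ hF.1, fun x y z ↦ ?_, fun x y z ↦ ?_⟩
    · simp only [LinearMap.smul_apply, smul_eq_mul]; linear_combination c * hF.2.1 x y z
    · simp only [LinearMap.smul_apply, smul_eq_mul]; linear_combination c * hF.2.2 x y z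

/-- The class `𝔾₅` (in dimension `2n+1`). -/
def G5 [FiniteDimensional ℝ V] (n : ℕ) : Submodule ℝ (Tensor03 V) where
  carrier := {F | F ∈ S.tensorSpace ∧ ∀ x y z, F x y z = S.leeForm F S.ξ / (2 * n) *
    (S.η y * S.g (S.φ x) (S.φ z) - S.η z * S.g (S.φ x) (S.φ y))}
  zero_mem' := ⟨zero_mem _, by simp [leeForm]⟩
  add_mem' {F F'} hF hF' := by
    refine ⟨add_mem hF.1 hF'.1, fun x y z ↦ ?_⟩
    simp only [LinearMap.add_apply, leeForm_add]; linear_combination hF.2 x y z + hF'.2 x y z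
  smul_mem' c {F} hF := by
    refine ⟨Submodule.smul_mem _ _ hF.1, fun x y z ↦ ?_⟩
    simp only [LinearMap.smul_apply, smul_eq_mul, leeForm_smul]; linear_combination c * hF.2 x y z

/-- The subclass `Ḡ₅` of `𝔾₅` given by `θ_F(ξ) = 2n`. -/
def G5bar [FiniteDimensional ℝ V] (n : ℕ) : Set (Tensor03 V) :=
  {F | F ∈ S.G5 n ∧ S.leeForm F S.ξ = 2 * n}

/-- The class `𝔾₁₀`. -/
def G10 : Submodule ℝ (Tensor03 V) where
  carrier := {F | F ∈ S.tensorSpace ∧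
    (∀ x y z, F x y z = -S.η y * F x z S.ξ + S.η z * F x y S.ξ) ∧
    (∀ x y, F x y S.ξ = F y x S.ξ) ∧ ∀ x y, F x y S.ξ = F (S.φ x) (S.φ y) S.ξ}
  zero_mem' := ⟨zero_mem _, by simp⟩
  add_mem' {F F'} hF hF' := by
    refine ⟨add_mem hF.1 hF'.1, fun x y z ↦ ?_, fun x y ↦ ?_, fun x y ↦ ?_⟩
    · simp only [LinearMap.add_apply]; linear_combination hF.2.1 x y z + hF'.2.1 x y z
    · simp only [LinearMap.add_apply]; linear_combination hF.2.2.1 x y + hF'.2.2.1 x y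
    · simp only [LinearMap.add_apply]; linear_combination hF.2.2.2 x y + hF'.2.2.2 x y
  smul_mem' c {F} hF := by
    refine ⟨Submodule.smul_mem _ _ hF.1, fun x y z ↦ ?_, fun x y ↦ ?_, fun x y ↦ ?_⟩
    · simp only [LinearMap.smul_apply, smul_eq_mul]; linear_combination c * hF.2.1 x y z
    · simp only [LinearMap.smul_apply, smul_eq_mul]; linear_combination c * hF.2.2.1 x y
    · simp only [LinearMap.smul_apply, smul_eq_mul]; linear_combination c * hF.2.2.2 x y

/-- The sum of `𝔾₄`, `𝔾₅` and `𝔾₁₀` is direct. -/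
lemma eq_zero_of_add_eq_zero [FiniteDimensional ℝ V] {n : ℕ} {F₄ F₅ F₁₀ : Tensor03 V}
    (h4 : F₄ ∈ S.G4) (h5 : F₅ ∈ S.G5 n) (h10 : F₁₀ ∈ S.G10) (h : F₅ + F₄ + F₁₀ = 0) :
    F₅ = 0 ∧ F₄ = 0 ∧ F₁₀ = 0 := by
  have e4 (x y : V) : F₄ x y S.ξ = 0 := by
    rw [(h4.1 x y S.ξ).1, ← h4.2.1 x S.ξ y, S.φ_ξ]; simp
  have e5 (x y : V) : F₅ (S.φ x) (S.φ y) S.ξ = -F₅ x y S.ξ := by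
    rw [h5.2, h5.2 x y]
    have h1 := S.compatible (S.φ x) (S.φ y)
    have h2 (x : V) : S.η (S.φ x) = 0 := by
      have := S.φ_sq (S.φ x)
      rw [S.φ_sq x, map_sub, map_smul, S.φ_ξ] at this
      simp only [smul_zero, sub_zero] at this
      have h3 : S.η (S.φ x) • S.ξ = 0 := sub_eq_self.mp this.symm
      simpa [S.η_ξ] using congrArg S.η h3
    rw [h2, h2] at h1
    simp only [S.φ_ξ, map_zero, h1, h2]
    ring
  have s (x y z : V) : F₅ x y z + F₄ x y z + F₁₀ x y z = 0 := by
    simpa using congr($h x y z)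
  have z5 (x y : V) : F₅ x y S.ξ = 0 := by
    have h1 := s x y S.ξ
    have h2 := s (S.φ x) (S.φ y) S.ξ
    rw [e4, e5, ← h10.2.2.2] at h2
    rw [e4] at h1
    linear_combination (h1 - h2) / 2
  have z10 (x y : V) : F₁₀ x y S.ξ = 0 := by
    have h1 := s x y S.ξ
    rw [e4, z5] at h1
    linear_combination h1
  have w10 : F₁₀ = 0 := by
    ext x y z; rw [h10.2.1, z10, z10]; simp
  have w5 : F₅ = 0 := by
    ext x y z
    have h1 := z5 x y
    have h2 := z5 x z
    rw [h5.2] at h1 h2 ⊢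
    simp only [S.φ_ξ, map_zero, S.η_ξ] at h1 h2
    simp only [LinearMap.zero_apply]
    linear_combination S.η z * h1 - S.η y * h2
  exact ⟨w5, by simpa [w5, w10] using h, w10⟩

end AlmostParacontactMetricSpace

/-! ### Almost paracontact metric manifolds -/

section Manifold

variable {E : Type*} [NormedAddCommGroup E] [NormedSpace ℝ E]
  {H : Type*} [TopologicalSpace H] (I : ModelWithCorners ℝ E H)
  (M : Type*) [TopologicalSpace M] [ChartedSpace H M] [IsManifold I ∞ M]

/-- An almost paracontact metric structure `(φ, ξ, η, g)` on the manifold `M`. -/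
structure AlmostParacontactMetricStructure where
  φ (p : M) : TangentSpace I p →L[ℝ] TangentSpace I p
  ξ (p : M) : TangentSpace I p
  η (p : M) : TangentSpace I p →L[ℝ] ℝ
  g : PseudoRiemannianMetric I M
  φ_contMDiff : ContMDiff I (I.prod 𝓘(ℝ, E →L[ℝ] E)) ∞
    (fun p ↦ TotalSpace.mk' (E →L[ℝ] E) p (φ p))
  ξ_contMDiff : ContMDiff I (I.prod 𝓘(ℝ, E)) ∞ (fun p ↦ TotalSpace.mk' E p (ξ p))
  η_contMDiff : ContMDiff I (I.prod 𝓘(ℝ, E →L[ℝ] ℝ)) ∞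
    (fun p ↦ TotalSpace.mk' (E →L[ℝ] ℝ) p (η p))
  φ_sq (p : M) (x : TangentSpace I p) : φ p (φ p x) = x - η p x • ξ p
  η_ξ (p : M) : η p (ξ p) = 1
  φ_ξ (p : M) : φ p (ξ p) = 0
  compatible (p : M) (x y : TangentSpace I p) :
    g.val p (φ p x) (φ p y) = -g.val p x y + η p x * η p y

end Manifold

namespace AlmostParacontactMetricStructure

variable {E : Type*} [NormedAddCommGroup E] [NormedSpace ℝ E]
  {H : Type*} [TopologicalSpace H] {I : ModelWithCorners ℝ E H}
  {M : Type*} [TopologicalSpace M] [ChartedSpace H M] [IsManifold I ∞ M]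
  (S : AlmostParacontactMetricStructure I M)

/-- The structure induced on the tangent space at `p`. -/
def tangent (p : M) : AlmostParacontactMetricSpace (TangentSpace I p) where
  φ := (S.φ p).toLinearMap
  ξ := S.ξ p
  η := (S.η p).toLinearMap
  g := S.g.bilin p
  φ_sq := S.φ_sq p
  η_ξ := S.η_ξ p
  φ_ξ := S.φ_ξ p
  g_symm := S.g.symm p
  g_nondegenerate := S.g.nondegenerate p
  compatible := S.compatible p

variable [FiniteDimensional ℝ E] [CompleteSpace E]

/-- The structure tensor `F(x, y, z) = g((∇_x φ) y, z)` at `p`, where `∇` is the Levi-Civita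
connection of `g`. -/
def structureTensor (p : M) : Tensor03 (TangentSpace I p) :=
  LinearMap.mk₂ ℝ
    (fun x y ↦ S.g.bilin p (covDerivEndomorphism S.g.leviCivita S.φ_contMDiff p y x))
    (by simp) (by simp) (by simp) (by simp)

/-- `(M, φ, ξ, η, g)` is paracontact metric: the fundamental form `ϕ(x, y) = g(φx, y)` equals
`dη`. -/
def IsParacontactMetric : Prop :=
  ∀ (p : M) (x y : TangentSpace I p), S.g.val p (S.φ p x) y = extDerivOneForm S.η_contMDiff p x y

end AlmostParacontactMetricStructure

end

namespace AlmostParacontactMetricSpace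

variable {V : Type*} [AddCommGroup V] [Module ℝ V] (S : AlmostParacontactMetricSpace V)

lemma η_φ (x : V) : S.η (S.φ x) = 0 := by
  have h := S.φ_sq (S.φ x)
  rw [S.φ_sq x, map_sub, map_smul, S.φ_ξ, smul_zero, sub_zero] at h
  simpa [S.η_ξ] using congrArg S.η (sub_eq_self.mp h.symm)

lemma g_ξ (x : V) : S.g x S.ξ = S.η x := by
  have h := S.compatible x S.ξ
  rw [S.φ_ξ, map_zero, S.η_ξ] at h
  linarith

lemma g_φ_right (x y : V) : S.g x (S.φ y) = -S.g (S.φ x) y := by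
  have h := S.compatible x (S.φ y)
  rw [S.φ_sq, map_sub, map_smul, S.g_ξ, S.η_φ] at h
  simp only [S.η_φ, smul_zero, mul_zero] at h
  linarith

variable {S}

lemma apply_φ_sq_right {F : Tensor03 V} (x y z : V) :
    F x y (S.φ (S.φ z)) = F x y z - S.η z * F x y S.ξ := by
  rw [S.φ_sq, map_sub, map_smul, smul_eq_mul]

lemma apply_φ_sq_middle {F : Tensor03 V} (x y z : V) :
    F x (S.φ (S.φ y)) z = F x y z - S.η y * F x S.ξ z := by
  rw [S.φ_sq]; simp

lemma apply_ξ_ξ {F : Tensor03 V} (hF : F ∈ S.tensorSpace) (x : V) : F x S.ξ S.ξ = 0 := by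
  have h := (hF x S.ξ S.ξ).1
  linarith

variable (S)

lemma distribution_gram_isUnit_det {ι : Type*} [Fintype ι] [DecidableEq ι]
    (e : Module.Basis ι ℝ S.distribution) :
    IsUnit (Matrix.of fun i j ↦ S.g (e i) (e j)).det := by
  let B : LinearMap.BilinForm ℝ S.distribution := S.g.restrict S.distribution
  have hB : B.Nondegenerate := by
    have hsep (x : S.distribution) (hx : ∀ y, B x y = 0) : x = 0 := by
      refine Subtype.ext <| S.g_nondegenerate x fun y ↦ ?_
      have hy : y - S.η y • S.ξ ∈ S.distribution := by simp [S.η_ξ]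
      have h : S.g x (y - S.η y • S.ξ) = 0 := hx ⟨_, hy⟩
      rw [map_sub, map_smul, S.g_ξ, show S.η x = 0 from x.2] at h
      simpa using h
    exact ⟨hsep, fun y hy ↦ hsep y fun x ↦ (S.g_symm _ _).trans (hy x)⟩
  have h := (LinearMap.BilinForm.nondegenerate_iff_det_ne_zero e).mp hB
  have hM : LinearMap.BilinForm.toMatrix e B = Matrix.of fun i j ↦ S.g (e i) (e j) := by
    ext i j; simp [B, LinearMap.BilinForm.toMatrix_apply]
  rw [← hM]
  exact h.isUnit

lemma finrank_distribution [FiniteDimensional ℝ V] {n : ℕ} (hn : Module.finrank ℝ V = 2 * n + 1) :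
    Module.finrank ℝ S.distribution = 2 * n := by
  have h := LinearMap.finrank_range_add_finrank_ker S.η
  have hr : LinearMap.range S.η = ⊤ :=
    LinearMap.range_eq_top.mpr fun c ↦ ⟨c • S.ξ, by simp [S.η_ξ]⟩
  rw [hr, finrank_top, Module.finrank_self] at h
  show Module.finrank ℝ (LinearMap.ker S.η) = _
  omega

lemma leeForm_ξ_of_apply_ξ [FiniteDimensional ℝ V] {n : ℕ}
    (hn : Module.finrank ℝ V = 2 * n + 1) {F : Tensor03 V}
    (hF : ∀ x y, F x y S.ξ = -S.g (S.φ x) (S.φ y)) : S.leeForm F S.ξ = 2 * n := by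
  simp only [leeForm]
  set e := Module.finBasis ℝ S.distribution
  set G := Matrix.of fun i j ↦ S.g (e i) (e j) with hG
  have hFG (i j) : F (e i) (e j) S.ξ = G j i := by
    rw [hF, S.compatible, show S.η (e i) = 0 from (e i).2]
    simp [hG, S.g_symm (e i)]
  have h : G⁻¹ * G = 1 := Matrix.nonsing_inv_mul _ (S.distribution_gram_isUnit_det e)
  calc ∑ i, ∑ j, G⁻¹ i j * F (e i) (e j) S.ξ = (G⁻¹ * G).trace := by
        simp [Matrix.trace, Matrix.mul_apply, hFG]
    _ = 2 * n := by
        rw [h, Matrix.trace_one, Fintype.card_fin, S.finrank_distribution hn]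
        push_cast; ring

/-- The tensor `η(y) g(φx, φz) - η(z) g(φx, φy)`, the model of the class `Ḡ₅`. -/
def contactTensor : Tensor03 V :=
  LinearMap.mk₂ ℝ
    (fun x y ↦ S.η y • (S.g (S.φ x)).comp S.φ - S.g (S.φ x) (S.φ y) • S.η)
    (fun x x' y ↦ by ext z; simp; ring) (fun c x y ↦ by ext z; simp; ring)
    (fun x y y' ↦ by ext z; simp; ring) (fun c x y ↦ by ext z; simp; ring)

lemma contactTensor_apply (x y z : V) : S.contactTensor x y z =
    S.η y * S.g (S.φ x) (S.φ z) - S.η z * S.g (S.φ x) (S.φ y) := by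
  simp [contactTensor]; ring

lemma contactTensor_apply_ξ (x y : V) : S.contactTensor x y S.ξ = -S.g (S.φ x) (S.φ y) := by
  rw [contactTensor_apply, S.φ_ξ, S.η_ξ]; simp

lemma contactTensor_mem_tensorSpace : S.contactTensor ∈ S.tensorSpace := by
  intro x y z
  simp only [contactTensor_apply, S.η_φ, S.φ_ξ, S.η_ξ, map_zero]
  constructor <;> ring

lemma contactTensor_mem_G5bar [FiniteDimensional ℝ V] {n : ℕ}
    (hn : Module.finrank ℝ V = 2 * n + 1) : S.contactTensor ∈ S.G5bar n := by
  have hθ := S.leeForm_ξ_of_apply_ξ hn S.contactTensor_apply_ξ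
  refine ⟨⟨S.contactTensor_mem_tensorSpace, fun x y z ↦ ?_⟩, hθ⟩
  rcases Nat.eq_zero_or_pos n with rfl | h
  · have hφ : S.φ x = 0 := by
      have h0 : S.distribution = ⊥ :=
        Submodule.finrank_eq_zero.mp (by rw [S.finrank_distribution hn])
      have hx : S.φ x ∈ S.distribution := S.η_φ x
      rwa [h0, Submodule.mem_bot] at hx
    rw [contactTensor_apply, hφ]
    simp
  · have : (n : ℝ) ≠ 0 := by positivity
    rw [hθ, div_self (by positivity), one_mul, contactTensor_apply]

lemma eq_contactTensor_of_mem_G5bar [FiniteDimensional ℝ V] {n : ℕ}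
    (hn : Module.finrank ℝ V = 2 * n + 1) {F : Tensor03 V} (hF : F ∈ S.G5bar n) :
    F = S.contactTensor := by
  have h := S.contactTensor_mem_G5bar hn
  ext x y z
  rw [hF.1.2, h.1.2, hF.2, h.2]

variable {S}

lemma apply_ξ_of_mem_G4 {F : Tensor03 V} (hF : F ∈ S.G4) (x y : V) : F x y S.ξ = 0 := by
  rw [(hF.1 x y S.ξ).1, ← hF.2.1 x S.ξ y, S.φ_ξ]
  simp

variable (S) in
/-- The condition on the structure tensor which expresses `ϕ = dη`. -/
def ContactCondition (F : Tensor03 V) : Prop :=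
  ∀ x y, S.g (S.φ x) y = (F y (S.φ x) S.ξ - F x (S.φ y) S.ξ) / 2

lemma contactCondition_of_mem [FiniteDimensional ℝ V] {n : ℕ}
    (hn : Module.finrank ℝ V = 2 * n + 1) {F : Tensor03 V}
    (hF : F ∈ S.G5bar n + (S.G4 : Set (Tensor03 V)) + (S.G10 : Set (Tensor03 V))) :
    S.ContactCondition F := by
  obtain ⟨_, ⟨F₅, h5, F₄, h4, rfl⟩, F₁₀, h10, rfl⟩ := hF
  rw [S.eq_contactTensor_of_mem_G5bar hn h5]
  intro x y
  simp only [LinearMap.add_apply, S.apply_ξ_of_mem_G4 h4, contactTensor_apply_ξ]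
  have e : F₁₀ x (S.φ y) S.ξ = F₁₀ y (S.φ x) S.ξ := by
    rw [h10.2.2.2, apply_φ_sq_middle, apply_ξ_ξ h10.1, h10.2.2.1 (S.φ x)]
    ring
  have h1 := S.g_φ_right x y
  have h2 := S.g_symm y (S.φ x)
  rw [e, S.compatible, S.compatible, S.η_φ, S.η_φ]
  linarith

lemma mem_of_contactCondition [FiniteDimensional ℝ V] {n : ℕ}
    (hn : Module.finrank ℝ V = 2 * n + 1) {F : Tensor03 V} (hF : F ∈ S.tensorSpace)
    (hcyc : ∀ x y z, F x y z + F y z x + F z x y = 0) (hc : S.ContactCondition F) :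
    F ∈ S.G5bar n + (S.G4 : Set (Tensor03 V)) + (S.G10 : Set (Tensor03 V)) := by
  let A : V → V → ℝ := fun x y ↦ F x y S.ξ + S.g (S.φ x) (S.φ y)
  have hA (x y) : A x y = F x y S.ξ + S.g (S.φ x) (S.φ y) := rfl
  have hξ (x) : F x S.ξ S.ξ = 0 := apply_ξ_ξ hF x
  have hξl (x) : F S.ξ x S.ξ = 0 := by
    have h := hc S.ξ (S.φ x)
    rw [S.φ_ξ, apply_φ_sq_middle, hξ] at h
    simp only [map_zero, LinearMap.zero_apply] at h
    linarith
  have hAφ (x y) : A x (S.φ y) = A y (S.φ x) := by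
    have h := hc x y
    have h1 := S.g_φ_right x y
    have h2 := S.g_symm x (S.φ y)
    simp only [hA, S.compatible, S.η_φ, S.g_symm y (S.φ x)]
    linarith
  have hAφφ (x y) : A (S.φ x) (S.φ y) = A y x := by
    rw [hAφ, hA, hA, apply_φ_sq_middle, hξ, S.φ_sq, map_sub, map_smul, S.η_φ]
    simp
  have hsymm (x y) : A x y = A y x := by
    have h1 := hcyc x y S.ξ
    have h2 := hcyc (S.φ x) (S.φ y) S.ξ
    rw [(hF y S.ξ x).1] at h1
    rw [(hF (S.φ y) S.ξ (S.φ x)).1] at h2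
    have h3 := (hF S.ξ x y).2
    rw [hξl, hξl] at h3
    have h4 := hAφφ x y
    have h5 := hAφφ y x
    have h6 := S.g_symm (S.φ x) (S.φ y)
    have h7 := S.g_symm (S.φ (S.φ x)) (S.φ (S.φ y))
    simp only [hA] at h4 h5 ⊢
    linarith
  have hAξ (x) : A x S.ξ = 0 := by rw [hA, hξ, S.φ_ξ]; simp
  let F₁₀ : Tensor03 V := LinearMap.mk₂ ℝ
    (fun x y ↦ A x y • S.η - S.η y • ((F x).flip S.ξ + (S.g (S.φ x)).comp S.φ))
    (fun x x' y ↦ by ext z; simp [hA]; ring) (fun c x y ↦ by ext z; simp [hA]; ring)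
    (fun x y y' ↦ by ext z; simp [hA]; ring) (fun c x y ↦ by ext z; simp [hA]; ring)
  have h10 (x y z) : F₁₀ x y z = -S.η y * A x z + S.η z * A x y := by
    simp [F₁₀, hA]; ring
  have h10ξ (x y) : F₁₀ x y S.ξ = A x y := by rw [h10, hAξ, S.η_ξ]; ring
  have m10 : F₁₀ ∈ S.G10 := by
    refine ⟨fun x y z ↦ ⟨?_, ?_⟩, fun x y z ↦ ?_, fun x y ↦ ?_, fun x y ↦ ?_⟩
    · rw [h10, h10]; ring
    · rw [h10ξ, h10ξ, h10, h10, S.η_φ, S.η_φ]; ring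
    · rw [h10ξ, h10ξ, h10]
    · rw [h10ξ, h10ξ, hsymm]
    · rw [h10ξ, h10ξ, hAφφ, hsymm]
  let F₄ : Tensor03 V := F + (-1 : ℝ) • S.contactTensor + (-1 : ℝ) • F₁₀
  have d4 (x y z) : F₄ x y z = F x y z - S.contactTensor x y z - F₁₀ x y z := by
    simp [F₄]; ring
  have t4 : F₄ ∈ S.tensorSpace :=
    add_mem (add_mem hF (Submodule.smul_mem _ _ S.contactTensor_mem_tensorSpace))
      (Submodule.smul_mem _ _ m10.1)
  have h4ξ (x y) : F₄ x y S.ξ = 0 := by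
    rw [d4, h10ξ, S.contactTensor_apply_ξ, hA]; ring
  have c4 (x y z) : F₄ x y z + F₄ y z x + F₄ z x y = 0 := by
    simp only [d4, h10, S.contactTensor_apply]
    rw [hsymm x z, hsymm y x, hsymm z y, S.g_symm (S.φ x) (S.φ z), S.g_symm (S.φ y) (S.φ x),
      S.g_symm (S.φ z) (S.φ y)]
    linear_combination hcyc x y z
  have hφ4 (x y z) : F₄ x (S.φ y) (S.φ z) = F₄ x y z := by
    have h := (t4 x y z).2
    rw [h4ξ, h4ξ] at h
    linarith
  have hswap (x y z) : F₄ x (S.φ y) z = F₄ x y (S.φ z) := by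
    rw [← hφ4 x y (S.φ z), apply_φ_sq_right, h4ξ]; ring
  have m4 : F₄ ∈ S.G4 := by
    let Q : V → V → V → ℝ := fun x y z ↦ F₄ (S.φ x) (S.φ y) z - F₄ x y z
    have hQ (x y z) : Q x y z + Q y z x = 0 := by
      have h1 := c4 (S.φ x) (S.φ y) z
      have h2 := c4 x y z
      rw [hφ4, ← hswap] at h1
      simp only [Q]
      linarith
    refine ⟨t4, fun x y z ↦ ?_, c4⟩
    have h1 := hQ x y z
    have h2 := hQ y z x
    have h3 := hQ z x y
    simp only [Q] at h1 h2 h3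
    linarith
  refine ⟨_, ⟨_, S.contactTensor_mem_G5bar hn, F₄, m4, rfl⟩, F₁₀, m10, ?_⟩
  ext x y z
  simp [F₄]
  ring

end AlmostParacontactMetricSpace

section DirectionalDerivative

variable {E : Type*} [NormedAddCommGroup E] [NormedSpace ℝ E]
  {H : Type*} [TopologicalSpace H] {I : ModelWithCorners ℝ E H}
  {M : Type*} [TopologicalSpace M] [ChartedSpace H M]

lemma mvfderiv_congr {f h : M → ℝ} {p : M} (hfh : f =ᶠ[nhds p] h) (x : TangentSpace I p) :
    d% f p x = d% h p x := by
  have := hfh.mfderiv_eq (I := I) (I' := 𝓘(ℝ, ℝ))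
  exact congr($this x)

/-- The derivative of a function along a vector field, read in the preferred chart at `p`. -/
lemma mvfderiv_extChartAt_symm_apply [IsManifold I 1 M] {f : M → ℝ} {X : Π p : M, TangentSpace I p}
    {p : M} {z : E} (hz : z ∈ (extChartAt I p).target)
    (hf : MDiffAt f ((extChartAt I p).symm z)) :
    d% f ((extChartAt I p).symm z) (X ((extChartAt I p).symm z)) =
      fderivWithin ℝ (f ∘ (extChartAt I p).symm) (Set.range I) z
        (mpullbackWithin 𝓘(ℝ, E) I (extChartAt I p).symm X (Set.range I) z) := by
  have hzr : z ∈ Set.range I := extChartAt_target_subset_range p hz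
  have hi := isInvertible_mfderivWithin_extChartAt_symm (I := I) hz
  have hc : mfderiv[Set.range I] (f ∘ (extChartAt I p).symm) z =
      (mfderiv% f ((extChartAt I p).symm z)).comp
        (mfderiv[Set.range I] (extChartAt I p).symm z) :=
    mfderiv_comp_mfderivWithin z hf (mdifferentiableWithinAt_extChartAt_symm hz)
      (I.uniqueMDiffOn z hzr)
  rw [mfderivWithin_eq_fderivWithin] at hc
  rw [hc, mpullbackWithin_apply]
  exact congrArg (d% f _) (hi.self_apply_inverse (X ((extChartAt I p).symm z))).symm

lemma inverse_inverse_apply_of_comp_eq_id {A D : E →L[ℝ] E} (hA : A.IsInvertible)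
    (hD : D.IsInvertible) (h : A ∘L D = .id ℝ E) (v : E) : D.inverse (A.inverse v) = v := by
  have hv : A (D v) = v := congr($h v)
  nth_rw 1 [← hv]
  rw [hA.inverse_apply_self, hD.inverse_apply_self]

lemma contDiffWithinAt_comp_extChartAt_symm {f : M → ℝ} {p : M} (hf : CMDiffAt 2 f p) :
    ContDiffWithinAt ℝ 2 (f ∘ (extChartAt I p).symm) (Set.range I) (extChartAt I p p) :=
  (contMDiffAt_iff.1 hf).2

variable [IsManifold I 2 M]

lemma eventually_mvfderiv_extChartAt_symm_apply {f : M → ℝ} {p : M} (hf : CMDiffAt 2 f p)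
    (X : Π p : M, TangentSpace I p) :
    ∀ᶠ z in nhdsWithin (extChartAt I p p) (Set.range I),
      d% f ((extChartAt I p).symm z) (X ((extChartAt I p).symm z)) =
        fderivWithin ℝ (f ∘ (extChartAt I p).symm) (Set.range I) z
          (mpullbackWithin 𝓘(ℝ, E) I (extChartAt I p).symm X (Set.range I) z) := by
  have : IsManifold I 1 M := IsManifold.of_le one_le_two
  have hc : Filter.Tendsto (extChartAt I p).symm
      (nhdsWithin (extChartAt I p p) (Set.range I)) (nhds p) := by
    have h := (continuousAt_extChartAt_symm (I := I) p).tendsto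
    rw [extChartAt_to_inv] at h
    exact h.mono_left nhdsWithin_le_nhds
  filter_upwards [extChartAt_target_mem_nhdsWithin p,
    hc.eventually ((contMDiffAt_iff_contMDiffAt_nhds (by simp)).1 hf)] with z hz hfz
  exact mvfderiv_extChartAt_symm_apply hz (hfz.mdifferentiableAt two_ne_zero)

variable [CompleteSpace E]

lemma differentiableWithinAt_fderivWithin_mpullbackWithin {f : M → ℝ}
    {X : Π p : M, TangentSpace I p} {p : M} (hf : CMDiffAt 2 f p) (hX : MDiffAt (T% X) p) :
    DifferentiableWithinAt ℝ (fun z ↦ fderivWithin ℝ (f ∘ (extChartAt I p).symm) (Set.range I) z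
      (mpullbackWithin 𝓘(ℝ, E) I (extChartAt I p).symm X (Set.range I) z))
      (Set.range I) (extChartAt I p p) := by
  have hz : extChartAt I p p ∈ Set.range I := extChartAt_target_subset_range p
    (mem_extChartAt_target p)
  have h1 := ((contDiffWithinAt_comp_extChartAt_symm hf).fderivWithin_right I.uniqueDiffOn
    (m := 1) (by norm_num) hz).differentiableWithinAt one_ne_zero
  have h2 := hX.mdifferentiableWithinAt (s := Set.univ)
    |>.differentiableWithinAt_mpullbackWithin_vectorField
  simp only [Set.preimage_univ, Set.univ_inter] at h2
  exact h1.clm_apply h2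

/-- The derivative of a `C²` function along a differentiable vector field is differentiable. -/
lemma mdifferentiableAt_mvfderiv_apply {f : M → ℝ} {X : Π p : M, TangentSpace I p} {p : M}
    (hf : CMDiffAt 2 f p) (hX : MDiffAt (T% X) p) :
    MDiffAt (fun q ↦ d% f q (X q)) p := by
  have : IsManifold I 1 M := IsManifold.of_le one_le_two
  have h1 := (differentiableWithinAt_fderivWithin_mpullbackWithin hf hX).mdifferentiableWithinAt
  have h2 : MDiffAt (extChartAt I p) p := mdifferentiableAt_extChartAt (mem_chart_source H p)
  have h3 := h1.comp p (h2.mdifferentiableWithinAt (s := Set.univ)) (fun q _ ↦ by simp)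
  rw [mdifferentiableWithinAt_univ] at h3
  refine h3.congr_of_eventuallyEq ?_
  have hc : Filter.Tendsto (extChartAt I p) (nhds p)
      (nhdsWithin (extChartAt I p p) (Set.range I)) :=
    tendsto_nhdsWithin_iff.mpr ⟨(continuousAt_extChartAt p).tendsto, .of_forall fun q ↦ by simp⟩
  filter_upwards [hc.eventually (eventually_mvfderiv_extChartAt_symm_apply hf X),
    extChartAt_source_mem_nhds (I := I) p] with q hq hqs
  rw [Function.comp_apply, ← hq, (extChartAt I p).left_inv hqs]

/-- For a function of class `C²` and differentiable vector fields, the derivative along the Lie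
bracket is the commutator of the derivatives. -/
lemma mvfderiv_mlieBracket_apply {f : M → ℝ} {X Y : Π p : M, TangentSpace I p} {p : M}
    (hf : CMDiffAt 2 f p) (hX : MDiffAt (T% X) p) (hY : MDiffAt (T% Y) p) :
    d% f p (mlieBracket I X Y p) =
      d% (fun q ↦ d% f q (Y q)) p (X p) - d% (fun q ↦ d% f q (X q)) p (Y p) := by
  have : IsManifold I 1 M := IsManifold.of_le one_le_two
  have hz := mem_extChartAt_target (I := I) p
  have hzr : extChartAt I p p ∈ Set.range I := extChartAt_target_subset_range p hz
  have key (h : M → ℝ) (hh : MDiffAt h p) (Z : Π p : M, TangentSpace I p) :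
      d% h p (Z p) = fderivWithin ℝ (h ∘ (extChartAt I p).symm) (Set.range I) (extChartAt I p p)
        (mpullbackWithin 𝓘(ℝ, E) I (extChartAt I p).symm Z (Set.range I) (extChartAt I p p)) := by
    have := mvfderiv_extChartAt_symm_apply (f := h) (X := Z) hz (by simpa using hh)
    rwa [extChartAt_to_inv] at this
  have second (Z W : Π p : M, TangentSpace I p) (hW : MDiffAt (T% W) p) :
      d% (fun q ↦ d% f q (W q)) p (Z p) =
        fderivWithin ℝ (fun z ↦ fderivWithin ℝ (f ∘ (extChartAt I p).symm) (Set.range I) z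
          (mpullbackWithin 𝓘(ℝ, E) I (extChartAt I p).symm W (Set.range I) z))
          (Set.range I) (extChartAt I p p)
        (mpullbackWithin 𝓘(ℝ, E) I (extChartAt I p).symm Z (Set.range I) (extChartAt I p p)) := by
    rw [key _ (mdifferentiableAt_mvfderiv_apply hf hW)]
    congr 1
    exact Filter.EventuallyEq.fderivWithin_eq_of_mem
      (eventually_mvfderiv_extChartAt_symm_apply hf W) hzr
  have hfield (Z : Π p : M, TangentSpace I p) (hZ : MDiffAt (T% Z) p) :
      DifferentiableWithinAt ℝ (mpullbackWithin 𝓘(ℝ, E) I (extChartAt I p).symm Z (Set.range I))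
        (Set.range I) (extChartAt I p p) := by
    have h := hZ.mdifferentiableWithinAt (s := Set.univ)
      |>.differentiableWithinAt_mpullbackWithin_vectorField
    simpa only [Set.preimage_univ, Set.univ_inter] using h
  rw [second X Y hY, second Y X hX,
    ← fderivWithin_apply_lieBracket (contDiffWithinAt_comp_extChartAt_symm hf) (by simp)
      I.uniqueDiffOn (I.range_subset_closure_interior hzr) hzr (hfield Y hY) (hfield X hX),
    key f (hf.mdifferentiableAt two_ne_zero) (mlieBracket I X Y)]
  congr 1
  rw [mpullbackWithin_apply, extChartAt_to_inv, ← mlieBracketWithin_univ, mlieBracketWithin_apply]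
  rw [Set.preimage_univ, Set.univ_inter]
  have hid := mfderiv_extChartAt_comp_mfderivWithin_extChartAt_symm (I := I) hz
  rw [extChartAt_to_inv] at hid
  have hA := isInvertible_mfderiv_extChartAt (mem_extChartAt_source (I := I) p)
  have hD := isInvertible_mfderivWithin_extChartAt_symm (I := I) hz
  exact inverse_inverse_apply_of_comp_eq_id (E := E) (A := mfderiv% (extChartAt I p) p)
    (D := mfderiv[Set.range I] (extChartAt I p).symm (extChartAt I p p)) hA hD hid _

end DirectionalDerivative

section Derivatives

variable {E : Type*} [NormedAddCommGroup E] [NormedSpace ℝ E]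
  {H : Type*} [TopologicalSpace H] {I : ModelWithCorners ℝ E H}
  {M : Type*} [TopologicalSpace M] [ChartedSpace H M] [IsManifold I ∞ M]

lemma covDerivEndomorphism_apply [FiniteDimensional ℝ E]
    (cov : CovariantDerivative I E (TangentSpace I : M → Type _))
    {φ : Π p : M, TangentSpace I p →L[ℝ] TangentSpace I p}
    (hφ : ContMDiff I (I.prod 𝓘(ℝ, E →L[ℝ] E)) ∞ (fun p ↦ TotalSpace.mk' (E →L[ℝ] E) p (φ p)))
    {p : M} {Y : Π p : M, TangentSpace I p} (hY : MDiffAt (T% Y) p) (x : TangentSpace I p) :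
    covDerivEndomorphism cov hφ p (Y p) x =
      cov (fun q ↦ φ q (Y q)) p x - φ p (cov Y p x) :=
  congr($(TensorialAt.mkHom_apply (covDerivEndomorphism_tensorial cov hφ p) hY) x)

lemma extDerivOneForm_apply [FiniteDimensional ℝ E] [CompleteSpace E]
    {η : Π p : M, TangentSpace I p →L[ℝ] ℝ}
    (hη : ContMDiff I (I.prod 𝓘(ℝ, E →L[ℝ] ℝ)) ∞ (fun p ↦ TotalSpace.mk' (E →L[ℝ] ℝ) p (η p)))
    {p : M} {X Y : Π p : M, TangentSpace I p} (hX : MDiffAt (T% X) p) (hY : MDiffAt (T% Y) p) :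
    extDerivOneForm hη p (X p) (Y p) = (1 / 2 : ℝ) * (d% (fun q ↦ η q (Y q)) p (X p)
      - d% (fun q ↦ η q (X q)) p (Y p) - η p (mlieBracket I X Y p)) :=
  TensorialAt.mkHom₂_apply _ _ hX hY

lemma oneForm_contMDiffAt {η : Π p : M, TangentSpace I p →L[ℝ] ℝ}
    (hη : ContMDiff I (I.prod 𝓘(ℝ, E →L[ℝ] ℝ)) ∞ (fun p ↦ TotalSpace.mk' (E →L[ℝ] ℝ) p (η p)))
    {Y : Π p : M, TangentSpace I p} {p : M} (hY : CMDiffAt 2 (T% Y) p) :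
    CMDiffAt 2 (fun q ↦ η q (Y q)) p := by
  have h := ContMDiffAt.clm_bundle_apply (F₁ := E) (F₂ := ℝ) (E₂ := Bundle.Trivial M ℝ)
    ((hη p).of_le (WithTop.coe_le_coe.mpr le_top : ((2 : ℕ∞) : WithTop ℕ∞) ≤ ∞)) hY
  simp only [contMDiffAt_totalSpace] at h
  exact h.2

lemma eventually_mdifferentiableAt {Y : Π p : M, TangentSpace I p} {p : M}
    (hY : CMDiffAt 2 (T% Y) p) : ∀ᶠ q in nhds p, MDiffAt (T% Y) q := by
  filter_upwards [(contMDiffAt_iff_contMDiffAt_nhds (by simp)).1 hY] with q hq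
  exact hq.mdifferentiableAt two_ne_zero

end Derivatives

namespace AlmostParacontactMetricStructure

variable {E : Type*} [NormedAddCommGroup E] [NormedSpace ℝ E]
  {H : Type*} [TopologicalSpace H] {I : ModelWithCorners ℝ E H}
  {M : Type*} [TopologicalSpace M] [ChartedSpace H M] [IsManifold I ∞ M]
  (S : AlmostParacontactMetricStructure I M)

lemma val_ξ (p : M) (x : TangentSpace I p) : S.g.val p x (S.ξ p) = S.η p x :=
  (S.tangent p).g_ξ x

lemma val_φ_right (p : M) (x y : TangentSpace I p) :
    S.g.val p x (S.φ p y) = -S.g.val p (S.φ p x) y :=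
  (S.tangent p).g_φ_right x y

lemma η_φ (p : M) (x : TangentSpace I p) : S.η p (S.φ p x) = 0 :=
  (S.tangent p).η_φ x

lemma φ_mdifferentiableAt {Y : Π p : M, TangentSpace I p} {p : M} (hY : MDiffAt (T% Y) p) :
    MDiffAt (T% (fun q ↦ S.φ q (Y q))) p :=
  endomorphismField_mdifferentiableAt S.φ_contMDiff hY

lemma ξ_mdifferentiableAt (p : M) : MDiffAt (T% S.ξ) p :=
  (S.ξ_contMDiff p).mdifferentiableAt (by simp)

variable [FiniteDimensional ℝ E] [CompleteSpace E] {S}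

lemma structureTensor_apply {p : M} {Y : Π p : M, TangentSpace I p} (hY : MDiffAt (T% Y) p)
    (x z : TangentSpace I p) :
    S.structureTensor p x (Y p) z =
      S.g.val p (S.g.leviCivita (fun q ↦ S.φ q (Y q)) p x) z
        - S.g.val p (S.φ p (S.g.leviCivita Y p x)) z := by
  change S.g.val p (covDerivEndomorphism S.g.leviCivita S.φ_contMDiff p (Y p) x) z = _
  rw [covDerivEndomorphism_apply _ _ hY, map_sub, _root_.sub_apply]

/-- The derivative of the fundamental form along `x`. -/
lemma mvfderiv_fundamentalForm {p : M} {Y Z : Π p : M, TangentSpace I p}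
    (hY : MDiffAt (T% Y) p) (hZ : MDiffAt (T% Z) p) (x : TangentSpace I p) :
    d% (fun q ↦ S.g.val q (S.φ q (Y q)) (Z q)) p x =
      S.structureTensor p x (Y p) (Z p) + S.g.val p (S.φ p (S.g.leviCivita Y p x)) (Z p)
        + S.g.val p (S.φ p (Y p)) (S.g.leviCivita Z p x) := by
  have hX := FiberBundle.mdifferentiableAt_extend I E x
  have h := S.g.leviCivita_metric hX (S.φ_mdifferentiableAt hY) hZ
  simp only [FiberBundle.extend_apply_self] at h
  rw [h, structureTensor_apply hY]
  ring

variable (S) in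
lemma structureTensor_mem_tensorSpace (p : M) :
    S.structureTensor p ∈ (S.tangent p).tensorSpace := by
  have skew (x y z : TangentSpace I p) :
      S.structureTensor p x y z = -S.structureTensor p x z y := by
    have hY := FiberBundle.mdifferentiableAt_extend I E y
    have hZ := FiberBundle.mdifferentiableAt_extend I E z
    have h1 := mvfderiv_fundamentalForm (S := S) hY hZ x
    have h2 := mvfderiv_fundamentalForm (S := S) hZ hY x
    have h3 : (fun q ↦ S.g.val q (S.φ q (FiberBundle.extend E y q)) (FiberBundle.extend E z q)) =
        -fun q ↦ S.g.val q (S.φ q (FiberBundle.extend E z q)) (FiberBundle.extend E y q) := by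
      ext q
      rw [Pi.neg_apply, S.g.symm q (S.φ q _) (FiberBundle.extend E y q), S.val_φ_right, neg_neg]
    rw [h3, mvfderiv_neg, _root_.neg_apply, h2] at h1
    simp only [FiberBundle.extend_apply_self] at h1
    rw [S.g.symm p (S.φ p z), S.val_φ_right, S.g.symm p (S.φ p y), S.val_φ_right] at h1
    linarith
  intro x y z
  refine ⟨skew x y z, ?_⟩
  have hY := FiberBundle.mdifferentiableAt_extend I E y
  have hZ := FiberBundle.mdifferentiableAt_extend I E z
  have h1 := mvfderiv_fundamentalForm (S := S) hY hZ x
  have h2 := mvfderiv_fundamentalForm (S := S) (S.φ_mdifferentiableAt hY)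
    (S.φ_mdifferentiableAt hZ) x
  have h3 : (fun q ↦ S.g.val q (S.φ q (S.φ q (FiberBundle.extend E y q)))
        (S.φ q (FiberBundle.extend E z q))) =
      -fun q ↦ S.g.val q (S.φ q (FiberBundle.extend E y q)) (FiberBundle.extend E z q) := by
    ext q
    rw [Pi.neg_apply, S.compatible, S.η_φ]
    ring
  rw [h3, mvfderiv_neg, _root_.neg_apply, h1] at h2
  have h4 := structureTensor_apply (S := S) hY x (FiberBundle.extend E z p)
  have h5 := structureTensor_apply (S := S) hY x (S.ξ p)
  have h6 := structureTensor_apply (S := S) hZ x (FiberBundle.extend E y p)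
  have h7 := structureTensor_apply (S := S) hZ x (S.ξ p)
  have h8 := skew x y z
  simp only [FiberBundle.extend_apply_self] at h2 h4 h5 h6 h7
  simp only [val_ξ, η_φ] at h5 h7
  rw [S.compatible, S.φ_sq, map_sub, map_smul, _root_.sub_apply, _root_.smul_apply,
    S.g.symm p (S.ξ p), S.val_ξ, S.g.symm p y, smul_eq_mul] at h2
  have h9 := S.val_φ_right p (S.g.leviCivita (FiberBundle.extend E z) p x) y
  have h10 := S.g.symm p (S.g.leviCivita (FiberBundle.extend E z) p x) (S.φ p y)
  change S.structureTensor p x y z = S.structureTensor p x (S.φ p y) (S.φ p z)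
    - S.η p y * S.structureTensor p x z (S.ξ p) + S.η p z * S.structureTensor p x y (S.ξ p)
  rw [h5, h7]
  linarith

lemma val_leviCivita_ξ {p : M} (x y : TangentSpace I p) :
    S.g.val p (S.g.leviCivita S.ξ p x) y = -S.structureTensor p x (S.φ p y) (S.ξ p) := by
  have hX := FiberBundle.mdifferentiableAt_extend I E x
  have hξ := S.ξ_mdifferentiableAt p
  have h1 := (S.structureTensor_mem_tensorSpace p x (S.φ p y) (S.ξ p)).1
  have h2 := structureTensor_apply (S := S) hξ x (S.φ p y)
  have h3 := S.g.leviCivita_metric hX hξ hξ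
  have h4 : (fun q ↦ S.φ q (S.ξ q)) = 0 := by ext1 q; exact S.φ_ξ q
  have h5 : (fun q ↦ S.g.val q (S.ξ q) (S.ξ q)) = fun _ ↦ 1 := by
    ext q; rw [S.val_ξ, S.η_ξ]
  rw [h5, mvfderiv_const, S.g.symm p (S.ξ p), S.val_ξ] at h3
  simp only [FiberBundle.extend_apply_self, _root_.zero_apply] at h3
  rw [h4, S.compatible, S.g.leviCivita.zero, Pi.zero_apply, _root_.zero_apply,
    map_zero, _root_.zero_apply] at h2
  have h6 : S.η p (S.g.leviCivita S.ξ p x) = 0 := by linarith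
  rw [h6] at h2
  linarith

lemma mvfderiv_η {p : M} {Y : Π p : M, TangentSpace I p} (hY : MDiffAt (T% Y) p)
    (x : TangentSpace I p) :
    d% (fun q ↦ S.η q (Y q)) p x =
      S.η p (S.g.leviCivita Y p x) - S.structureTensor p x (S.φ p (Y p)) (S.ξ p) := by
  have hX := FiberBundle.mdifferentiableAt_extend I E x
  have h := S.g.leviCivita_metric hX hY (S.ξ_mdifferentiableAt p)
  simp only [FiberBundle.extend_apply_self, val_ξ] at h
  rw [h, S.g.symm p (Y p), val_leviCivita_ξ]
  ring

lemma leviCivita_sub {p : M} {X Y : Π p : M, TangentSpace I p} (hX : MDiffAt (T% X) p)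
    (hY : MDiffAt (T% Y) p) :
    S.g.leviCivita Y p (X p) - S.g.leviCivita X p (Y p) = mlieBracket I X Y p := by
  have h := S.g.leviCivita_torsion
  rw [CovariantDerivative.torsion_eq_zero_iff] at h
  exact h hX hY

lemma extDerivOneForm_η {p : M} (x y : TangentSpace I p) :
    extDerivOneForm S.η_contMDiff p x y = (S.structureTensor p y (S.φ p x) (S.ξ p)
      - S.structureTensor p x (S.φ p y) (S.ξ p)) / 2 := by
  have hX := FiberBundle.mdifferentiableAt_extend I E x
  have hY := FiberBundle.mdifferentiableAt_extend I E y
  have h := extDerivOneForm_apply S.η_contMDiff hX hY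
  rw [← leviCivita_sub (S := S) hX hY, map_sub, mvfderiv_η hX, mvfderiv_η hY] at h
  simp only [FiberBundle.extend_apply_self] at h
  rw [h]
  ring

lemma isParacontactMetric_iff :
    S.IsParacontactMetric ↔ ∀ p, (S.tangent p).ContactCondition (S.structureTensor p) := by
  refine forall_congr' fun p ↦ forall₂_congr fun x y ↦ ?_
  rw [extDerivOneForm_η]
  rfl

end AlmostParacontactMetricStructure

namespace AlmostParacontactMetricStructure

variable {E : Type*} [NormedAddCommGroup E] [NormedSpace ℝ E]
  {H : Type*} [TopologicalSpace H] {I : ModelWithCorners ℝ E H}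
  {M : Type*} [TopologicalSpace M] [ChartedSpace H M] [IsManifold I ∞ M]
  [FiniteDimensional ℝ E] [CompleteSpace E] {S : AlmostParacontactMetricStructure I M}

lemma IsParacontactMetric.fundamentalForm_apply (hS : S.IsParacontactMetric) {p : M}
    {X Y : Π p : M, TangentSpace I p} (hX : MDiffAt (T% X) p) (hY : MDiffAt (T% Y) p) :
    S.g.val p (S.φ p (X p)) (Y p) = (1 / 2 : ℝ) * (d% (fun q ↦ S.η q (Y q)) p (X p)
      - d% (fun q ↦ S.η q (X q)) p (Y p) - S.η p (mlieBracket I X Y p)) := by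
  rw [hS, extDerivOneForm_apply S.η_contMDiff hX hY]

lemma IsParacontactMetric.mvfderiv_fundamentalForm_eq (hS : S.IsParacontactMetric) {p : M}
    {X Y : Π p : M, TangentSpace I p} (hX : CMDiffAt 2 (T% X) p) (hY : CMDiffAt 2 (T% Y) p)
    (hXY : MDiffAt (T% (mlieBracket I X Y)) p) (z : TangentSpace I p) :
    2 * d% (fun q ↦ S.g.val q (S.φ q (X q)) (Y q)) p z =
      d% (fun q ↦ d% (fun q ↦ S.η q (Y q)) q (X q)) p z
        - d% (fun q ↦ d% (fun q ↦ S.η q (X q)) q (Y q)) p z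
        - d% (fun q ↦ S.η q (mlieBracket I X Y q)) p z := by
  have : IsManifold I 2 M := IsManifold.of_le (n := ∞) (WithTop.coe_le_coe.mpr le_top)
  have hX1 := hX.mdifferentiableAt two_ne_zero
  have hY1 := hY.mdifferentiableAt two_ne_zero
  have hB := S.g.mdifferentiableAt (S.φ_mdifferentiableAt hX1) hY1
  have h1 := mdifferentiableAt_mvfderiv_apply (oneForm_contMDiffAt S.η_contMDiff hY) hX1
  have h2 := mdifferentiableAt_mvfderiv_apply (oneForm_contMDiffAt S.η_contMDiff hX) hY1
  have h3 := oneForm_mdifferentiableAt S.η_contMDiff hXY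
  have e : (fun q ↦ S.g.val q (S.φ q (X q)) (Y q)) + (fun q ↦ S.g.val q (S.φ q (X q)) (Y q))
      =ᶠ[nhds p] (fun q ↦ d% (fun q ↦ S.η q (Y q)) q (X q))
        - (fun q ↦ d% (fun q ↦ S.η q (X q)) q (Y q))
        - (fun q ↦ S.η q (mlieBracket I X Y q)) := by
    filter_upwards [eventually_mdifferentiableAt hX, eventually_mdifferentiableAt hY]
      with q hXq hYq
    simp only [Pi.add_apply, Pi.sub_apply]
    rw [hS.fundamentalForm_apply hXq hYq]
    ring
  have h := mvfderiv_congr e z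
  rw [mvfderiv_add hB hB, mvfderiv_sub (h1.sub h2) h3, mvfderiv_sub h1 h2] at h
  simp only [_root_.add_apply, _root_.sub_apply] at h
  linarith

/-- On a paracontact metric manifold the fundamental form is closed, so that the cyclic sum of the
structure tensor vanishes. -/
lemma IsParacontactMetric.cyclic_sum_structureTensor (hS : S.IsParacontactMetric) (p : M)
    (x y z : TangentSpace I p) :
    S.structureTensor p x y z + S.structureTensor p y z x + S.structureTensor p z x y = 0 := by
  have : IsManifold I 2 M := IsManifold.of_le (n := ∞) (WithTop.coe_le_coe.mpr le_top)
  have i3 : IsManifold I (((2 : ℕ∞) : WithTop ℕ∞) + 1) M :=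
    IsManifold.of_le (n := ∞) (WithTop.coe_le_coe.mpr (le_top : (2 + 1 : ℕ∞) ≤ ⊤))
  have i3' : IsManifold I (minSmoothness ℝ 3) M := by
    rw [minSmoothness_of_isRCLikeNormedField]
    exact IsManifold.of_le (n := ∞) (WithTop.coe_le_coe.mpr (le_top : (3 : ℕ∞) ≤ ⊤))
  have smooth (v : TangentSpace I p) : CMDiffAt 2 (T% (FiberBundle.extend E v)) p :=
    FiberBundle.contMDiffAt_extend I E v
  obtain ⟨X, hX, rfl⟩ : ∃ X : Π p : M, TangentSpace I p, CMDiffAt 2 (T% X) p ∧ X p = x :=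
    ⟨_, smooth x, by simp⟩
  obtain ⟨Y, hY, rfl⟩ : ∃ Y : Π p : M, TangentSpace I p, CMDiffAt 2 (T% Y) p ∧ Y p = y :=
    ⟨_, smooth y, by simp⟩
  obtain ⟨Z, hZ, rfl⟩ : ∃ Z : Π p : M, TangentSpace I p, CMDiffAt 2 (T% Z) p ∧ Z p = z :=
    ⟨_, smooth z, by simp⟩
  have hX1 := hX.mdifferentiableAt two_ne_zero
  have hY1 := hY.mdifferentiableAt two_ne_zero
  have hZ1 := hZ.mdifferentiableAt two_ne_zero
  have bracket {V W : Π p : M, TangentSpace I p} (hV : CMDiffAt 2 (T% V) p)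
      (hW : CMDiffAt 2 (T% W) p) : MDiffAt (T% (mlieBracket I V W)) p := by
    have h := ContMDiffAt.mlieBracket_vectorField (m := 1) (n := 2) hV hW
      (by rw [minSmoothness_of_isRCLikeNormedField]; norm_num)
    exact h.mdifferentiableAt one_ne_zero
  have half {U V W : Π p : M, TangentSpace I p} (hU : CMDiffAt 2 (T% U) p)
      (hV : CMDiffAt 2 (T% V) p) (hW : CMDiffAt 2 (T% W) p) :
      2 * (S.structureTensor p (W p) (U p) (V p)
        + S.g.val p (S.φ p (S.g.leviCivita U p (W p))) (V p)
        - S.g.val p (S.φ p (S.g.leviCivita V p (W p))) (U p)) =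
      d% (fun q ↦ d% (fun q ↦ S.η q (V q)) q (U q)) p (W p)
        - d% (fun q ↦ d% (fun q ↦ S.η q (U q)) q (V q)) p (W p)
        - d% (fun q ↦ S.η q (mlieBracket I U V q)) p (W p) := by
    rw [← hS.mvfderiv_fundamentalForm_eq hU hV (bracket hU hV), mvfderiv_fundamentalForm
      (hU.mdifferentiableAt two_ne_zero) (hV.mdifferentiableAt two_ne_zero),
      S.g.symm p (S.φ p (U p)), S.val_φ_right]
    ring
  have dbracket {U V W : Π p : M, TangentSpace I p} (hU : CMDiffAt 2 (T% U) p)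
      (hV : CMDiffAt 2 (T% V) p) (hW : CMDiffAt 2 (T% W) p) :
      2 * (S.g.val p (S.φ p (S.g.leviCivita V p (U p))) (W p)
        - S.g.val p (S.φ p (S.g.leviCivita U p (V p))) (W p)) =
      d% (fun q ↦ d% (fun q ↦ S.η q (W q)) q (V q)) p (U p)
        - d% (fun q ↦ d% (fun q ↦ S.η q (W q)) q (U q)) p (V p)
        - d% (fun q ↦ S.η q (mlieBracket I U V q)) p (W p)
        - S.η p (mlieBracket I (mlieBracket I U V) W p) := by
    have hU1 := hU.mdifferentiableAt two_ne_zero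
    have hV1 := hV.mdifferentiableAt two_ne_zero
    have hW1 := hW.mdifferentiableAt two_ne_zero
    rw [← mvfderiv_mlieBracket_apply (oneForm_contMDiffAt S.η_contMDiff hW) hU1 hV1,
      ← _root_.sub_apply, ← map_sub, ← map_sub, leviCivita_sub hU1 hV1,
      hS.fundamentalForm_apply (bracket hU hV) hW1]
    ring
  have jacobi : mlieBracket I (mlieBracket I X Y) Z p + mlieBracket I (mlieBracket I Y Z) X p
      + mlieBracket I (mlieBracket I Z X) Y p = 0 := by
    have h := leibniz_identity_mlieBracket_apply (I := I) (𝕜 := ℝ) (U := X) (V := Y) (W := Z)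
      (x := p) (by simpa using hX) (by simpa using hY) (by simpa using hZ)
    have hneg : mlieBracket I Z X = (-1 : ℝ) • mlieBracket I X Z := by
      rw [mlieBracket_swap, neg_one_smul]
    rw [mlieBracket_swap_apply (V := X),
      mlieBracket_swap_apply (V := Y) (W := mlieBracket I X Z)] at h
    rw [hneg, mlieBracket_const_smul_left (bracket hX hZ), neg_one_smul,
      ← sub_eq_zero.mpr h.symm]
    abel
  have jη := congrArg (S.η p) jacobi
  simp only [map_add, map_zero] at jη
  have a1 := half hX hY hZ
  have a2 := half hY hZ hX
  have a3 := half hZ hX hY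
  have b1 := dbracket hX hY hZ
  have b2 := dbracket hY hZ hX
  have b3 := dbracket hZ hX hY
  linarith

end AlmostParacontactMetricStructure

theorem theorem2p3 (n : ℕ) (M : Type*) [TopologicalSpace M]
    [ChartedSpace (EuclideanSpace ℝ (Fin (2 * n + 1))) M] [IsManifold (𝓡 (2 * n + 1)) ∞ M]
    (S : AlmostParacontactMetricStructure (𝓡 (2 * n + 1)) M) :
    S.IsParacontactMetric ↔
      (∀ p, S.structureTensor p ∈ (S.tangent p).G5bar n) ∨
      (∀ p, S.structureTensor p ∈ (S.tangent p).G5bar n + ((S.tangent p).G4 : Set _)) ∨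
      (∀ p, S.structureTensor p ∈ (S.tangent p).G5bar n + ((S.tangent p).G10 : Set _)) ∨
      (∀ p, S.structureTensor p ∈
        (S.tangent p).G5bar n + ((S.tangent p).G4 : Set _) + ((S.tangent p).G10 : Set _)) := by
  have hn (p : M) : Module.finrank ℝ (TangentSpace (𝓡 (2 * n + 1)) p) = 2 * n + 1 :=
    finrank_euclideanSpace_fin
  constructor
  · intro hS
    exact .inr <| .inr <| .inr fun p ↦ AlmostParacontactMetricSpace.mem_of_contactCondition (hn p)
      (S.structureTensor_mem_tensorSpace p) (hS.cyclic_sum_structureTensor p)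
      (AlmostParacontactMetricStructure.isParacontactMetric_iff.mp hS p)
  · intro h
    rw [AlmostParacontactMetricStructure.isParacontactMetric_iff]
    intro p
    refine AlmostParacontactMetricSpace.contactCondition_of_mem (hn p) ?_
    have h4 : (0 : Tensor03 (TangentSpace (𝓡 (2 * n + 1)) p)) ∈ ((S.tangent p).G4 : Set _) :=
      zero_mem _
    have h10 : (0 : Tensor03 (TangentSpace (𝓡 (2 * n + 1)) p)) ∈ ((S.tangent p).G10 : Set _) :=
      zero_mem _
    rcases h with h | h | h | h
    · exact ⟨_, ⟨_, h p, 0, h4, add_zero _⟩, 0, h10, add_zero _⟩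
    · exact ⟨_, h p, 0, h10, add_zero _⟩
    · obtain ⟨F₅, h5, F₁₀, h', e⟩ := h p
      exact ⟨_, ⟨_, h5, 0, h4, add_zero _⟩, F₁₀, h', e⟩
    · exact h p
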